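/- Let $L$ be a relational language, let $\mathcal K$ be a class of finite $L$-structures, and let $\mathbf K$ be an $L$-structure with universe $\mathbb N=\{0,1,2,\dots\}$ which is the Fraïssé limit of $\mathcal K$: $\mathbf K$ is ultrahomogeneous and $\mathcal K$ is the class of finite structures that embed into $\mathbf K$. Let $G=\mathrm{Aut}(\mathbf K)$ with the topology of pointwise convergence. A $G$-flow is a nonempty compact Hausdorff space with a jointly continuous right action of $G$; it is minimal if every orbit is dense. A $G$-map is a continuous map that respects the actions, and an isomorphism of $G$-flows is a bijective $G$-map. A universal minimal flow of $G$ is a minimal $G$-flow that admits a $G$-map to every minimal $G$-flow; $M(G)$ denotes the universal minimal flow of $G$, which exists and is unique up to isomorphism. For structures $\mathbf A,\mathbf B$ let $\mathrm{Emb}(\mathbf A,\mathbf B)$ be the set of embeddings of $\mathbf A$ in $\mathbf B$. For $n\in\mathbb N$ let $\mathbf A_n\subseteq\mathbf K$ be the substructure with universe $\{0,\dots,n\}$, let $H_n=\mathrm{Emb}(\mathbf A_n,\mathbf K)$, and let $\beta H_n$ be the space of ultrafilters on the set $H_n$. For $m\le n$ let $\rho^n_m\colon\beta H_n\to\beta H_m$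 be the pushforward of ultrafilters along the restriction map $f\mapsto f|_{\mathbf A_m}$, and let $$\varprojlim\beta H_n=\Big\{\alpha\in\prod_n\beta H_n:\ \rho^n_m(\alpha(n))=\alpha(m)\text{ for all }m\le n\Big\}$$ with the subspace topology of the product. The group $G$ acts on it on the right as follows: for $S\subseteq H_m$ and any $n$ with $g(\mathbf A_m)\subseteq\mathbf A_n$, $$S\in(\alpha g)(m)\iff\{f\in H_n:\ f\circ g|_{\mathbf A_m}\in S\}\in\alpha(n).$$ A set $S\subseteq H_n$ is thick if for every $\mathbf B\in\mathcal K$ into which $\mathbf A_n$ embeds there is $f\in\mathrm{Emb}(\mathbf B,\mathbf K)$ with $f\circ\mathrm{Emb}(\mathbf A_n,\mathbf B)\subseteq S$. A set $P$ of ultrafilters on $H_n$ is thick if every $S\subseteq H_n$ that belongs to all members of $P$ is thick. The (embedding) Ramsey degree of $\mathbf A\in\mathcal K$ is the least $k\in\mathbb N$, if there is one, such that for every $\mathbf B\in\mathcal K$ into which $\mathbf A$ embeds and every $r>k$ there is $\mathbf C\in\mathcal K$ such that for every coloring $\gamma$ of $\mathrm{Emb}(\mathbf A,\mathbf C)$ with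 $r$ colors there is $f\in\mathrm{Emb}(\mathbf B,\mathbf C)$ with $|\gamma(f\circ\mathrm{Emb}(\mathbf A,\mathbf B))|\le k$. **Corollary.** For each $n$ let $Y_n\subseteq\beta H_n$ be a finite thick set such that $\mathbf A_n$ has Ramsey degree $|Y_n|$, and suppose that $\rho^n_m(Y_n)\subseteq Y_m$ for all $m\le n$. Let $Y=\varprojlim Y_n=\{\alpha\in\varprojlim\beta H_n:\alpha(n)\in Y_n\text{ for all }n\}$. Then $Y$ is $G$-invariant and, with the action of $G$ restricted to it, $Y\cong M(G)$ as $G$-flows; that is, $Y$ is a universal minimal flow of $G$ and is isomorphic to every universal minimal flow of $G$. -/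

import Mathlib

open CategoryTheory
open scoped FirstOrder

universe u v w

namespace UMF

/-! ### Topological dynamics

A right action of `G` on `X` is an action of the opposite group, `x · g = MulOpposite.op g • x`. -/

section Flows

/-- `X` with its given right `G`-action is a `G`-flow: a nonempty compact Hausdorff space on which
`G` acts by a jointly continuous (right) action. -/
structure IsFlow (G : Type u) [Group G] [TopologicalSpace G]
    (X : Type v) [TopologicalSpace X] [MulAction Gᵐᵒᵖ X] : Prop where
  nonempty : Nonempty X
  compact : CompactSpace X
  hausdorff : T2Space X
  continuous_action : Continuous fun p : X × G => MulOpposite.op p.2 • p.1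

/-- A minimal `G`-flow: every orbit is dense. -/
structure IsMinimalFlow (G : Type u) [Group G] [TopologicalSpace G]
    (X : Type v) [TopologicalSpace X] [MulAction Gᵐᵒᵖ X] : Prop where
  isFlow : IsFlow G X
  dense_orbit : ∀ x : X, Dense (Set.range fun g : G => MulOpposite.op g • x)

/-- A `G`-map: a continuous map that respects the (right) actions. -/
structure IsGMap (G : Type u) [Group G]
    {X : Type v} [TopologicalSpace X] [MulAction Gᵐᵒᵖ X]
    {Z : Type w} [TopologicalSpace Z] [MulAction Gᵐᵒᵖ Z] (f : X → Z) : Prop where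
  continuous : Continuous f
  map_act : ∀ (g : G) (x : X), f (MulOpposite.op g • x) = MulOpposite.op g • f x

/-- Isomorphism of `G`-flows: there is a bijective `G`-map. -/
def FlowIso (G : Type u) [Group G]
    (X : Type v) [TopologicalSpace X] [MulAction Gᵐᵒᵖ X]
    (Z : Type w) [TopologicalSpace Z] [MulAction Gᵐᵒᵖ Z] : Prop :=
  ∃ f : X → Z, IsGMap G f ∧ Function.Bijective f

/-- `X` is a universal minimal `G`-flow: it is a minimal `G`-flow which admits a `G`-map to every
minimal `G`-flow `Z` (with underlying type in the universe `w`). -/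
structure IsUniversalMinimalFlow.{w', u', v'} (G : Type u') [Group G] [TopologicalSpace G]
    (X : Type v') [TopologicalSpace X] [MulAction Gᵐᵒᵖ X] : Prop where
  isMinimalFlow : IsMinimalFlow G X
  universal : ∀ (Z : Type w') [TopologicalSpace Z] [MulAction Gᵐᵒᵖ Z],
    IsMinimalFlow G Z → ∃ f : X → Z, IsGMap G f

end Flows

/-! ### Structural Ramsey theory for embeddings -/

section Ramsey

variable {L : FirstOrder.Language.{u, v}}

/-- For `S ⊆ Emb(A, D)`: `S` is thick (with respect to the class `𝒞`) if for every `B ∈ 𝒞` which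
embeds `A` there is `f ∈ Emb(B, D)` with `f ∘ Emb(A, B) ⊆ S`. -/
def IsThick (𝒞 : Set (Bundled.{w} L.Structure)) {A D : Type w} [L.Structure A] [L.Structure D]
    (S : Set (A ↪[L] D)) : Prop :=
  ∀ B ∈ 𝒞, Nonempty (A ↪[L] B) → ∃ f : B ↪[L] D, ∀ e : A ↪[L] B, f.comp e ∈ S

/-- The arrow `C ↪ (B)^A_{r,k}`: for every coloring `γ` of `Emb(A, C)` with `r` colors there is
`f ∈ Emb(B, C)` such that `γ` takes at most `k` values on `f ∘ Emb(A, B)`. -/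
def Arrow (L : FirstOrder.Language.{u, v}) (A B C : Type w) [L.Structure A] [L.Structure B] [L.Structure C]
    (r k : ℕ) : Prop :=
  ∀ γ : (A ↪[L] C) → Fin r, ∃ f : B ↪[L] C,
    (Set.range fun e : A ↪[L] B => γ (f.comp e)).ncard ≤ k

/-- `A` has (embedding) Ramsey degree `k` in the class `𝒞`: `k` is the least number such that for
every `B ∈ 𝒞` which embeds `A` and every `r > k` there is `C ∈ 𝒞` with `C ↪ (B)^A_{r,k}`.
In particular the degree is finite. -/
def HasRamseyDegree (𝒞 : Set (Bundled.{w} L.Structure)) (A : Type w) [L.Structure A]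
    (k : ℕ) : Prop :=
  IsLeast {k : ℕ | ∀ B ∈ 𝒞, Nonempty (A ↪[L] B) → ∀ r : ℕ, k < r →
    ∃ C ∈ 𝒞, Arrow L A B C r k} k

end Ramsey

/-! ### The automorphism group and the inverse limit of the spaces `β H_n` -/

section Limit

variable (L : FirstOrder.Language.{u, v}) [L.Structure ℕ]

/-- The automorphism group of the structure `K` with universe `ℕ`. -/
abbrev Aut : Type := ℕ ≃[L] ℕ

variable {L} in
/-- Multiplication of automorphisms is composition: `(g * h) i = g (h i)`. -/
instance : Group (Aut L) where
  mul g h := g.comp h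
  one := FirstOrder.Language.Equiv.refl L ℕ
  inv g := g.symm
  mul_assoc _ _ _ := rfl
  one_mul _ := rfl
  mul_one _ := rfl
  inv_mul_cancel g := FirstOrder.Language.Equiv.ext fun i => g.symm_apply_apply i

/-- The topology of pointwise convergence on the automorphism group. -/
instance : TopologicalSpace (Aut L) :=
  TopologicalSpace.induced (fun (g : Aut L) (i : ℕ) => g i) inferInstance

variable {L} in
/-- The least `n` with `g(A_m) ⊆ A_n`. -/
def bd (g : Aut L) (m : ℕ) : ℕ := (Finset.Iic m).sup g

variable {L} in
theorem le_bd (g : Aut L) (m : ℕ) : ∀ i ≤ m, g i ≤ bd g m := fun _ hi =>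
  Finset.le_sup (f := g) (Finset.mem_Iic.2 hi)

variable [L.IsRelational]

/-- The finite substructure `A_n` of `K` with universe `{0, …, n}`. -/
def A (n : ℕ) : L.Substructure ℕ where
  carrier := Set.Iic n
  fun_mem f := isEmptyElim f

/-- `H_n = Emb(A_n, K)`. -/
abbrev H (n : ℕ) : Type := A L n ↪[L] ℕ

variable {L}

/-- For `e ∈ Emb(A_m, A_n)`, the map `H_n → H_m` that sends `f` to `f ∘ e`. -/
def pull {m n : ℕ} (e : A L m ↪[L] A L n) (f : H L n) : H L m := f.comp e

/-- The inclusion embedding of `A_m` in `A_n` for `m ≤ n`. -/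
def incl {m n : ℕ} (h : m ≤ n) : A L m ↪[L] A L n :=
  FirstOrder.Language.Substructure.inclusion (show A L m ≤ A L n from Set.Iic_subset_Iic.2 h)

/-- The bonding map `β H_n → β H_m` for `m ≤ n`: the continuous extension of restriction
`f ↦ f|_{A_m}`, i.e. the pushforward of ultrafilters along it. -/
def bond {m n : ℕ} (h : m ≤ n) (p : Ultrafilter (H L n)) : Ultrafilter (H L m) :=
  p.map (pull (incl h))

variable (L) in
/-- The inverse limit of the spaces `β H_n`, a subspace of their product. Here `β H_n` is
Mathlib's space of ultrafilters on `H_n`. -/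
def LimBeta : Type :=
  {α : ∀ n, Ultrafilter (H L n) // ∀ (m n : ℕ) (h : m ≤ n), bond h (α n) = α m}

instance : TopologicalSpace (LimBeta L) := instTopologicalSpaceSubtype

/-- The restriction `g|_{A_m}` of an automorphism `g`, as an embedding of `A_m` in `A_n`, when
`g(A_m) ⊆ A_n`. -/
def res (g : Aut L) {m n : ℕ} (h : ∀ i ≤ m, g i ≤ n) : A L m ↪[L] A L n :=
  FirstOrder.Language.Embedding.codRestrict (A L n) (g.toEmbedding.comp (A L m).subtype)
    fun i => h i.1 i.2

theorem map_pull_pull {l m n : ℕ} (e : A L l ↪[L] A L m) (d : A L m ↪[L] A L n)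
    (p : Ultrafilter (H L n)) :
    (p.map (pull d)).map (pull e) = p.map (pull (d.comp e)) := by
  rw [Ultrafilter.map_map]; rfl

/-- The pushforward of `α n` along `f ↦ f ∘ g|_{A_m}` does not depend on `n`, as long as
`g(A_m) ⊆ A_n`. -/
theorem map_res_eq (α : LimBeta L) (g : Aut L) {m n k : ℕ}
    (h : ∀ i ≤ m, g i ≤ n) (h' : ∀ i ≤ m, g i ≤ k) :
    (α.1 n).map (pull (res g h)) = (α.1 k).map (pull (res g h')) := by
  have key : ∀ {a b : ℕ} (ha : ∀ i ≤ m, g i ≤ a) (hb : ∀ i ≤ m, g i ≤ b), a ≤ b →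
      (α.1 a).map (pull (res g ha)) = (α.1 b).map (pull (res g hb)) := by
    intro a b ha hb hab
    rw [← α.2 a b hab, bond, map_pull_pull]
    rfl
  rcases le_total n k with hnk | hkn
  · exact key h h' hnk
  · exact (key h' h hkn).symm

/-- The right action of `G` on the inverse limit: `(α · g)(m)` is the pushforward of `α(n)` along
the map `f ↦ f ∘ g|_{A_m}` from `H_n` to `H_m`, for any `n` with `g(A_m) ⊆ A_n`. -/
def act (α : LimBeta L) (g : Aut L) : LimBeta L :=
  ⟨fun m => (α.1 (bd g m)).map (pull (res g (le_bd g m))), by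
    intro m n h
    rw [bond, map_pull_pull]
    exact map_res_eq α g (fun i hi => le_bd g n i (hi.trans h)) (le_bd g m)⟩

theorem act_val (α : LimBeta L) (g : Aut L) {m n : ℕ} (h : ∀ i ≤ m, g i ≤ n) :
    (act α g).1 m = (α.1 n).map (pull (res g h)) :=
  map_res_eq α g _ h

/-- `S ∈ (α · g)(m)` iff `{f ∈ H_n : f ∘ g|_{A_m} ∈ S} ∈ α(n)`, for any `n` with
`g(A_m) ⊆ A_n`. -/
theorem mem_act_iff (α : LimBeta L) (g : Aut L) {m n : ℕ} (h : ∀ i ≤ m, g i ≤ n)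
    (S : Set (H L m)) :
    S ∈ (act α g).1 m ↔ {f : H L n | pull (res g h) f ∈ S} ∈ α.1 n := by
  rw [act_val α g h]; rfl

theorem act_one (α : LimBeta L) : act α (1 : Aut L) = α :=
  Subtype.ext <| funext fun m => by
    rw [act_val α 1 (n := m) (fun i hi => hi)]
    exact α.2 m m le_rfl

theorem act_mul (α : LimBeta L) (g h : Aut L) : act α (g * h) = act (act α g) h :=
  Subtype.ext <| funext fun m => by
    have e : ∀ i ≤ m, (g * h) i ≤ bd g (bd h m) := fun i hi => le_bd g _ _ (le_bd h m i hi)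
    rw [act_val α (g * h) e, act_val (act α g) h (le_bd h m), act_val α g (le_bd g (bd h m)),
      map_pull_pull]
    rfl

instance : MulAction (Aut L)ᵐᵒᵖ (LimBeta L) where
  smul g α := act α g.unop
  one_smul α := act_one α
  mul_smul g h α := act_mul α h.unop g.unop

/-- A set of ultrafilters on `H_n` is thick if every `S ⊆ H_n` which belongs to all of them is
thick. -/
def IsThickFamily (𝒦 : Set (Bundled.{0} L.Structure)) {n : ℕ} (P : Set (Ultrafilter (H L n))) :
    Prop :=
  ∀ S : Set (H L n), (∀ p ∈ P, S ∈ p) → IsThick 𝒦 S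

/-- Sets `Y_n ⊆ β H_n` form an inverse system (under the bonding maps of the `β H_n`). -/
def IsInverseSystem (Y : ∀ n, Set (Ultrafilter (H L n))) : Prop :=
  ∀ (m n : ℕ) (h : m ≤ n), Set.MapsTo (bond h) (Y n) (Y m)

/-- The inverse limit of the `Y_n`, as a subset of the inverse limit of the `β H_n`. -/
def limSet (Y : ∀ n, Set (Ultrafilter (H L n))) : Set (LimBeta L) :=
  {α | ∀ n, α.1 n ∈ Y n}

end Limit

end UMF

/-! The inverse limit of the `β H_n` is the greatest ambit of `G`. By ultrahomogeneity `G` is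
densely embedded in it (`ofAut`), and orbit maps into flows extend to it (`IsFlow.exists_isGMap`).
Hence every minimal subflow maps to every minimal flow, and three facts about the limit `Y` remain.

Invariance and minimality use that `|Y_n|` is exactly the Ramsey degree: the degree gives a coloring
that shows `|Y_n|` colors on every copy of some `B`, so no member of `Y_n` can be dropped without
losing thickness (`exists_not_isThick`). A translate leaving `Y` (`map_pull_mem`), or an orbit
missing some `q ∈ Y_m` in coordinate `m` (`exists_pull_eq`), would make such a smaller family thick.

Uniqueness rests on coalescence (`injective_of_isGMap`): the degree bounds the number of values of
stabilizer-invariant colorings of a minimal flow (`IsMinimalFlow.card_le_of_invariant`), so an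
endomorphism of `Y` induces a permutation of each finite `Y_m`. -/

namespace UMF

open Set Filter FirstOrder.Language

/-! ### Ramsey degrees and thick families of ultrafilters -/

section RamseyDegree

variable {L : FirstOrder.Language.{u, v}} [L.Structure ℕ] [L.IsRelational]

instance finite_A (n : ℕ) : Finite (A L n) := (Set.finite_Iic n).to_subtype

instance finite_embedding {M N : Type*} [L.Structure M] [L.Structure N] [Finite M] [Finite N] :
    Finite (M ↪[L] N) :=
  Finite.of_injective (fun f => (f : M → N)) DFunLike.coe_injective

theorem exists_aut (hu : L.IsUltrahomogeneous ℕ) {n : ℕ} (f : H L n) :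
    ∃ g : Aut L, ∀ i : A L n, f i = g i := by
  obtain ⟨g, hg⟩ := hu (A L n) Substructure.FG.of_finite f
  exact ⟨g, fun i => by rw [hg]; rfl⟩

theorem A_mem {𝒦 : Set (Bundled.{0} L.Structure)} (h𝒦 : L.age ℕ = 𝒦) (n : ℕ) :
    (⟨A L n, inferInstance⟩ : Bundled.{0} L.Structure) ∈ 𝒦 := by
  rw [← h𝒦]
  exact ⟨Structure.FG.of_finite, ⟨(A L n).subtype⟩⟩

theorem finite_of_mem {𝒦 : Set (Bundled.{0} L.Structure)} (h𝒦 : L.age ℕ = 𝒦)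
    {B : Bundled.{0} L.Structure} (hB : B ∈ 𝒦) : Finite B := by
  rw [← h𝒦] at hB
  exact hB.1.finite

theorem exists_embedding_A {B : Type*} [L.Structure B] [Finite B] (f : B ↪[L] ℕ) :
    ∃ N, ∀ b, f b ∈ A L N := by
  obtain ⟨N, hN⟩ := (Set.finite_range f).bddAbove
  exact ⟨N, fun b => hN ⟨b, rfl⟩⟩

/-- The `A_N` are cofinal in the age, so they suffice as test structures. -/
theorem isThick_iff {𝒦 : Set (Bundled.{0} L.Structure)} (h𝒦 : L.age ℕ = 𝒦) {m : ℕ}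
    {S : Set (H L m)} :
    IsThick 𝒦 S ↔ ∀ N, ∃ f : H L N, ∀ e : A L m ↪[L] A L N, pull e f ∈ S := by
  constructor
  · intro h N
    by_cases hne : Nonempty (A L m ↪[L] A L N)
    · exact h _ (A_mem h𝒦 N) hne
    · exact ⟨(A L N).subtype, fun e => (hne ⟨e⟩).elim⟩
  · intro h B hB _
    have := finite_of_mem h𝒦 hB
    rw [← h𝒦] at hB
    obtain ⟨b⟩ := hB.2
    obtain ⟨N, hN⟩ := exists_embedding_A b
    obtain ⟨f, hf⟩ := h N
    exact ⟨f.comp (b.codRestrict (A L N) hN), fun e => hf ((b.codRestrict (A L N) hN).comp e)⟩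

theorem IsThickFamily.nonempty {𝒦 : Set (Bundled.{0} L.Structure)} (h𝒦 : L.age ℕ = 𝒦) {m : ℕ}
    {P : Set (Ultrafilter (H L m))} (h : IsThickFamily 𝒦 P) : P.Nonempty := by
  by_contra hP
  rw [not_nonempty_iff_eq_empty] at hP
  obtain ⟨f, hf⟩ := h ∅ (by simp [hP]) _ (A_mem h𝒦 m) ⟨Embedding.refl L _⟩
  exact hf (Embedding.refl L _)

/-- Upper bound from the Ramsey degree, for colorings of embeddings into the limit. -/
theorem HasRamseyDegree.exists_ncard_le {𝒦 : Set (Bundled.{0} L.Structure)} (h𝒦 : L.age ℕ = 𝒦)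
    {m k : ℕ} (h : HasRamseyDegree 𝒦 (A L m) k) {r : ℕ} (hr : k < r) (γ : H L m → Fin r)
    {N : ℕ} (hN : Nonempty (A L m ↪[L] A L N)) :
    ∃ f : H L N, (range fun e : A L m ↪[L] A L N => γ (pull e f)).ncard ≤ k := by
  obtain ⟨C, hC, hCa⟩ := h.1 _ (A_mem h𝒦 N) hN r hr
  rw [← h𝒦] at hC
  obtain ⟨c⟩ := hC.2
  obtain ⟨f, hf⟩ := hCa fun e => γ (c.comp e)
  exact ⟨c.comp f, hf⟩

/-- Lower bound from the Ramsey degree: by compactness there is one coloring of the embeddings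
into the limit that takes at least `k` values on every copy of some `B`. -/
theorem HasRamseyDegree.exists_coloring {𝒦 : Set (Bundled.{0} L.Structure)} (h𝒦 : L.age ℕ = 𝒦)
    {m k : ℕ} (h : HasRamseyDegree 𝒦 (A L m) k) (hk : 0 < k) :
    ∃ B ∈ 𝒦, Nonempty (A L m ↪[L] B) ∧ ∃ (r : ℕ) (γ : H L m → Fin r),
      ∀ f : B ↪[L] ℕ, k ≤ (range fun e : A L m ↪[L] B => γ (f.comp e)).ncard := by
  -- Leastness of `k` makes `k - 1` fail; `hk` keeps the subtraction from truncating.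
  have hlow : k - 1 ∉ {k : ℕ | ∀ B ∈ 𝒦, Nonempty (A L m ↪[L] B) → ∀ r : ℕ, k < r →
      ∃ C ∈ 𝒦, Arrow L (A L m) B C r k} := fun hmem => by
    have := h.2 hmem
    omega
  simp only [mem_ofPred_eq, not_forall] at hlow
  obtain ⟨B, hB, hne, r, hr, hC⟩ := hlow
  refine ⟨B, hB, hne, r, ?_⟩
  have hbad : ∀ n : ℕ, ∃ γ : (A L m ↪[L] A L n) → Fin r, ∀ f : B ↪[L] A L n,
      k ≤ (range fun e : A L m ↪[L] B => γ (f.comp e)).ncard := by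
    intro n
    by_contra hcon
    push Not at hcon
    refine hC ⟨_, A_mem h𝒦 n, fun γ => (hcon γ).imp fun f hf => ?_⟩
    omega
  choose γ hγ using hbad
  have : Finite B := finite_of_mem h𝒦 hB
  -- The limit coloring gives `x` the color it has in `γ n` for almost all `n` along a nonprincipal
  -- ultrafilter.
  have hlim : ∀ x : H L m, ∃ c : Fin r, ∀ᶠ n in (hyperfilter ℕ : Filter ℕ),
      ∃ hx : ∀ i, x i ∈ A L n, γ n (x.codRestrict (A L n) hx) = c := by
    intro x
    obtain ⟨N, hN⟩ := exists_embedding_A x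
    have hev : ∀ᶠ n in (hyperfilter ℕ : Filter ℕ), ∃ c : Fin r,
        ∃ hx : ∀ i, x i ∈ A L n, γ n (x.codRestrict (A L n) hx) = c := by
      have : ∀ᶠ n in (hyperfilter ℕ : Filter ℕ), N ≤ n :=
        (Nat.hyperfilter_le_atTop) (eventually_ge_atTop N)
      filter_upwards [this] with n hn
      exact ⟨_, fun i => le_trans (hN i) hn, rfl⟩
    exact Ultrafilter.eventually_exists_iff.1 hev
  choose δ hδ using hlim
  refine ⟨δ, fun f => ?_⟩
  obtain ⟨N, hN⟩ := exists_embedding_A f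
  have h1 : ∀ᶠ n in (hyperfilter ℕ : Filter ℕ), N ≤ n :=
    (Nat.hyperfilter_le_atTop) (eventually_ge_atTop N)
  have h2 := eventually_all.2 fun e : A L m ↪[L] B => hδ (f.comp e)
  obtain ⟨n, hn, hn'⟩ := (h1.and h2).exists
  refine (hγ n (f.codRestrict (A L n) fun b => le_trans (hN b) hn)).trans_eq ?_
  congr 2
  funext e
  obtain ⟨hx, he⟩ := hn' e
  exact he

/-- In a finite family whose size is the Ramsey degree no member can be left out. -/
theorem exists_not_isThick {𝒦 : Set (Bundled.{0} L.Structure)} (h𝒦 : L.age ℕ = 𝒦) {m : ℕ}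
    {P : Set (Ultrafilter (H L m))} (hP : P.Finite) (hdeg : HasRamseyDegree 𝒦 (A L m) P.ncard)
    {q : Ultrafilter (H L m)} (hq : q ∈ P) :
    ∃ X : Set (H L m), (∀ p ∈ P, p ≠ q → X ∈ p) ∧ ¬ IsThick 𝒦 X := by
  have hpos : 0 < P.ncard := (ncard_pos hP).2 ⟨q, hq⟩
  obtain ⟨B, hB, hne, r, γ, hγ⟩ := hdeg.exists_coloring h𝒦 hpos
  have hc : ∀ p : Ultrafilter (H L m), ∃ c : Fin r, ∀ᶠ x in (p : Filter (H L m)), γ x = c :=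
    fun p => Ultrafilter.eventually_exists_iff.1 (Eventually.of_forall fun x => ⟨_, rfl⟩)
  choose c hc using hc
  -- The colors typical for the other members number fewer than `P.ncard`, but every copy of `B`
  -- shows at least that many.
  refine ⟨{x | γ x ∈ c '' (P \ {q})}, fun p hp hpq => ?_, fun hX => ?_⟩
  · filter_upwards [hc p] with x hx
    exact ⟨p, ⟨hp, hpq⟩, hx.symm⟩
  · obtain ⟨f, hf⟩ := hX B hB hne
    have h1 := hγ f
    have h2 : (range fun e : A L m ↪[L] B => γ (f.comp e)) ⊆ c '' (P \ {q}) := by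
      rintro _ ⟨e, rfl⟩
      exact hf e
    have h3 := ncard_le_ncard h2 (toFinite _)
    have h4 := ncard_image_le (f := c) (hP.sdiff (t := {q}))
    have h5 := ncard_sdiff_singleton_lt_of_mem hq hP
    omega

/-- Finite sets of ultrafilters are closed: otherwise the union of finitely many sets, each
separating a member of `P` from `p`, contradicts `h`. -/
theorem mem_of_forall_mem {β : Type*} {P : Set (Ultrafilter β)} (hP : P.Finite)
    {p : Ultrafilter β} (h : ∀ S : Set β, (∀ q ∈ P, S ∈ q) → S ∈ p) : p ∈ P := by
  by_contra hp
  have hsep : ∀ q ∈ P, ∃ S, S ∈ q ∧ S ∉ p := fun q hq => by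
    by_contra hcon
    push Not at hcon
    exact hp (Ultrafilter.coe_le_coe.1 hcon ▸ hq)
  choose! S hS hS' using hsep
  have := h (⋃ q ∈ P, S q) fun q hq => mem_of_superset (hS q hq) (subset_biUnion_of_mem hq)
  obtain ⟨q, hq, hqS⟩ := (Ultrafilter.finite_biUnion_mem_iff hP).1 this
  exact hS' q hq hqS

/-- Pulling back along an arbitrary embedding of `A_m` in `A_n` maps `Y_n` to `Y_m`, as soon as
this holds for the inclusion. -/
theorem map_pull_mem {𝒦 : Set (Bundled.{0} L.Structure)} (h𝒦 : L.age ℕ = 𝒦)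
    (hu : L.IsUltrahomogeneous ℕ) {m n : ℕ} (hmn : m ≤ n)
    {P : Set (Ultrafilter (H L m))} (hP : P.Finite)
    {Q : Set (Ultrafilter (H L n))} (hQ : Q.Finite) (hthick : IsThickFamily 𝒦 Q)
    (hdeg : HasRamseyDegree 𝒦 (A L n) Q.ncard) (hbond : MapsTo (bond hmn) Q P)
    (e : A L m ↪[L] A L n) {p : Ultrafilter (H L n)} (hp : p ∈ Q) : p.map (pull e) ∈ P := by
  refine mem_of_forall_mem hP fun S hS => ?_
  by_contra hSp
  obtain ⟨X, hX, hXt⟩ := exists_not_isThick h𝒦 hQ hdeg hp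
  -- The complement of `pull e ⁻¹' S` accounts for `p`, and `X` for the other members of `Q`.
  have hall : ∀ q ∈ Q, (X ∪ (pull e ⁻¹' S)ᶜ) ∩ pull (incl hmn) ⁻¹' S ∈ q := by
    intro q hq
    refine inter_mem ?_ (hS _ (hbond hq))
    by_cases hqp : q = p
    · subst hqp
      exact mem_of_superset (Ultrafilter.compl_mem_iff_notMem.2 hSp) subset_union_right
    · exact mem_of_superset (hX q hq hqp) subset_union_left
  refine hXt ((isThick_iff h𝒦).2 fun N => ?_)
  -- a stage at which every embedding of `A_m` in `A_N` extends to `A_n`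
  have hext : ∀ d : A L m ↪[L] A L N, ∃ g : Aut L, ∀ i : A L m, (d i : ℕ) = g i := fun d =>
    exists_aut hu ((A L N).subtype.comp d)
  choose g hg using hext
  obtain ⟨M, hM⟩ := (Set.finite_range fun d => bd (g d) n).bddAbove
  have hgM : ∀ d, ∀ i ≤ n, g d i ≤ max M N := fun d i hi =>
    ((le_bd (g d) n i hi).trans (hM ⟨d, rfl⟩)).trans (le_max_left _ _)
  obtain ⟨f, hf⟩ := (isThick_iff h𝒦).1 (hthick _ hall) (max M N)
  refine ⟨pull (incl (le_max_right M N)) f, fun d => ?_⟩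
  have h1 := hf ((incl (le_max_right M N)).comp d)
  refine h1.1.resolve_right fun h2 => h2 ?_
  -- `f ∘ d ∘ e` is also the restriction to `A_m` of `f` composed with a copy of `A_n`, so it lies
  -- in `S`.
  have h3 := (hf (res (g (d.comp e)) (hgM (d.comp e)))).2
  have h4 : (res (g (d.comp e)) (hgM (d.comp e))).comp (incl hmn) =
      ((incl (le_max_right M N)).comp d).comp e := by
    ext i
    exact (hg (d.comp e) i).symm
  change f.comp ((res (g (d.comp e)) (hgM (d.comp e))).comp (incl hmn)) ∈ S at h3
  rw [h4] at h3
  exact h3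

/-- A point of the limit whose translates all avoid `q` in coordinate `m` would make the rest of
the family thick. -/
theorem exists_pull_eq {𝒦 : Set (Bundled.{0} L.Structure)} (h𝒦 : L.age ℕ = 𝒦) {m : ℕ}
    {P : Set (Ultrafilter (H L m))} (hP : P.Finite) (hdeg : HasRamseyDegree 𝒦 (A L m) P.ncard)
    (α : LimBeta L) (hα : ∀ (n : ℕ) (e : A L m ↪[L] A L n), (α.1 n).map (pull e) ∈ P)
    {q : Ultrafilter (H L m)} (hq : q ∈ P) :
    ∃ (n : ℕ) (e : A L m ↪[L] A L n), (α.1 n).map (pull e) = q := by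
  by_contra! hcon
  obtain ⟨X, hX, hXt⟩ := exists_not_isThick h𝒦 hP hdeg hq
  refine hXt ((isThick_iff h𝒦).2 fun n => ?_)
  have : ∀ᶠ f in (α.1 n : Filter (H L n)), ∀ e : A L m ↪[L] A L n, pull e f ∈ X :=
    eventually_all.2 fun e => hX _ (hα n e) (hcon n e)
  exact this.exists

end RamseyDegree

end UMF

namespace UMF

open Set Filter Topology FirstOrder.Language

/-! ### Topology of the automorphism group and of the inverse limit -/

section Continuity

variable {L : FirstOrder.Language.{u, v}} [L.Structure ℕ]

theorem continuous_aut_apply (i : ℕ) : Continuous fun g : Aut L => g i :=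
  (continuous_apply i).comp continuous_induced_dom

theorem eventually_eqOn (g : Aut L) (n : ℕ) : ∀ᶠ h in 𝓝 g, ∀ i ≤ n, h i = g i := by
  have : ∀ᶠ h in 𝓝 g, ∀ i ∈ Iic n, h i = g i :=
    (eventually_all_finite (finite_Iic n)).2 fun i _ =>
      (continuous_aut_apply i).continuousAt.eventually (p := fun j => j = g i)
        (mem_nhds_discrete.2 rfl)
  exact this

theorem exists_forall_eqOn {g : Aut L} {U : Set (Aut L)} (hU : U ∈ 𝓝 g) :
    ∃ n, ∀ h : Aut L, (∀ i ≤ n, h i = g i) → h ∈ U := by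
  rw [nhds_induced, mem_comap] at hU
  obtain ⟨V, hV, hVU⟩ := hU
  rw [nhds_pi, Filter.mem_pi] at hV
  obtain ⟨I, hI, t, ht, htV⟩ := hV
  obtain ⟨n, hn⟩ := hI.bddAbove
  refine ⟨n, fun h hh => hVU (htV fun i hi => ?_)⟩
  change h i ∈ t i
  rw [hh i (hn hi)]
  exact mem_of_mem_nhds (ht i)

variable [L.IsRelational]

theorem pull_res {m n : ℕ} {g h : Aut L} (hg : ∀ i ≤ m, g i ≤ n) (hh : ∀ i ≤ m, h i ≤ n)
    (hgh : ∀ i ≤ m, h i = g i) : res h hh = res g hg := by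
  ext i
  exact hgh i i.2

theorem continuous_map_ultrafilter {β γ : Type*} (f : β → γ) :
    Continuous (Ultrafilter.map f) := by
  refine continuous_generateFrom_iff.2 ?_
  rintro _ ⟨s, rfl⟩
  exact ultrafilter_isOpen_basic (f ⁻¹' s)

theorem continuous_coord (n : ℕ) : Continuous fun α : LimBeta L => α.1 n :=
  (continuous_apply n).comp continuous_subtype_val

/-- Near `g` all automorphisms agree on `A_m`, so coordinate `m` of the action is locally one fixed
pushforward. -/
theorem continuous_act :
    Continuous fun p : LimBeta L × Aut L => MulOpposite.op p.2 • p.1 := by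
  refine continuous_induced_rng.2 (continuous_pi fun m => continuous_iff_continuousAt.2 ?_)
  rintro ⟨α, g⟩
  have h1 : Continuous fun p : LimBeta L × Aut L =>
      (p.1.1 (bd g m)).map (pull (res g (le_bd g m))) :=
    (continuous_map_ultrafilter _).comp ((continuous_coord _).comp continuous_fst)
  refine h1.continuousAt.congr ?_
  have h2 : ∀ᶠ p : LimBeta L × Aut L in 𝓝 (α, g), ∀ i ≤ m, p.2 i = g i :=
    continuous_snd.continuousAt.eventually (p := fun h : Aut L => ∀ i ≤ m, h i = g i)
      (eventually_eqOn g m)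
  filter_upwards [h2] with p hp
  have hb : ∀ i ≤ m, p.2 i ≤ bd g m := fun i hi => (hp i hi).trans_le (le_bd g m i hi)
  change _ = (act p.1 p.2).1 m
  rw [act_val p.1 p.2 hb, pull_res (le_bd g m) hb hp]

theorem continuous_act_left (g : Aut L) :
    Continuous fun α : LimBeta L => MulOpposite.op g • α := by
  have h : Continuous fun α : LimBeta L => (α, g) := Continuous.prodMk_left g
  exact (continuous_act.comp h :)

instance : T2Space (LimBeta L) :=
  inferInstanceAs (T2Space (Subtype _))

instance : CompactSpace (LimBeta L) := by
  have h : IsClosed {α : ∀ n, Ultrafilter (H L n) |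
      ∀ (m n : ℕ) (h : m ≤ n), bond h (α n) = α m} := by
    simp only [ofPred_forall]
    exact isClosed_iInter fun m => isClosed_iInter fun n => isClosed_iInter fun h =>
      isClosed_eq ((continuous_map_ultrafilter _).comp (continuous_apply n)) (continuous_apply m)
  exact isCompact_iff_compactSpace.1 h.isCompact

/-- A neighborhood base of the limit: sets of the form `{β | S ∈ β n}`. -/
theorem exists_basic_nhds {α : LimBeta L} {U : Set (LimBeta L)} (hU : U ∈ 𝓝 α) :
    ∃ (n : ℕ) (S : Set (H L n)), S ∈ α.1 n ∧ ∀ β : LimBeta L, S ∈ β.1 n → β ∈ U := by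
  have hind : IsInducing fun β : LimBeta L => β.1 := ⟨rfl⟩
  rw [hind.nhds_eq_comap, mem_comap] at hU
  obtain ⟨V, hV, hVU⟩ := hU
  rw [nhds_pi, Filter.mem_pi] at hV
  obtain ⟨I, hI, t, ht, htV⟩ := hV
  obtain ⟨n, hn⟩ := hI.bddAbove
  have hbasis : ∀ i, ∃ S : Set (H L i), S ∈ α.1 i ∧ ∀ p : Ultrafilter (H L i), S ∈ p → p ∈ t i := by
    intro i
    obtain ⟨_, ⟨S, rfl⟩, hS, hSt⟩ := ultrafilterBasis_is_basis.mem_nhds_iff.1 (ht i)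
    exact ⟨S, hS, fun p hp => hSt hp⟩
  choose S hS hSt using hbasis
  -- By coherence, finitely many coordinate conditions become one condition in a coordinate above
  -- them all.
  refine ⟨n, {f | ∀ i (hi : i ∈ I), pull (incl (hn hi)) f ∈ S i}, ?_, fun β hβ => ?_⟩
  · have : ∀ᶠ f in (α.1 n : Filter (H L n)), ∀ i : I, pull (incl (hn i.2)) f ∈ S i := by
      have := hI.to_subtype
      refine eventually_all.2 fun i => ?_
      have := hS i
      rw [← α.2 i n (hn i.2)] at this
      exact this
    filter_upwards [this] with f hf i hi using hf ⟨i, hi⟩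
  · refine hVU (htV fun i hi => hSt i _ ?_)
    change S i ∈ β.1 i
    rw [← β.2 i n (hn hi)]
    exact Ultrafilter.mem_map.2 (mem_of_superset hβ fun f hf => hf i hi)

/-- The canonical map of the group in the inverse limit: `g` goes to the principal ultrafilters
at its restrictions. -/
def ofAut (g : Aut L) : LimBeta L :=
  ⟨fun n => pure (g.toEmbedding.comp (A L n).subtype), fun _ _ _ => rfl⟩

theorem mem_ofAut {g : Aut L} {n : ℕ} {S : Set (H L n)} :
    S ∈ (ofAut g).1 n ↔ g.toEmbedding.comp (A L n).subtype ∈ S := Iff.rfl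

theorem ofAut_mul (g h : Aut L) : ofAut (g * h) = MulOpposite.op h • ofAut g := rfl

theorem denseRange_ofAut (hu : L.IsUltrahomogeneous ℕ) :
    DenseRange (ofAut : Aut L → LimBeta L) := by
  intro α
  rw [mem_closure_iff_nhds]
  intro U hU
  obtain ⟨n, S, hS, hSU⟩ := exists_basic_nhds hU
  obtain ⟨f, hf⟩ := Ultrafilter.nonempty_of_mem hS
  obtain ⟨g, hg⟩ := exists_aut hu f
  refine ⟨ofAut g, hSU _ ?_, g, rfl⟩
  have : g.toEmbedding.comp (A L n).subtype = f := by
    ext i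
    exact (hg i).symm
  rwa [mem_ofAut, this]

theorem isInducing_ofAut : IsInducing (ofAut : Aut L → LimBeta L) := by
  refine isInducing_iff_nhds.2 fun g => le_antisymm ?_ fun U hU => ?_
  · refine map_le_iff_le_comap.1 fun U hU => ?_
    obtain ⟨n, S, hS, hSU⟩ := exists_basic_nhds hU
    refine mem_map.2 (mem_of_superset (eventually_eqOn g n) fun h hh => ?_)
    refine hSU _ ?_
    have : h.toEmbedding.comp (A L n).subtype = g.toEmbedding.comp (A L n).subtype := by
      ext i
      exact hh i i.2
    rwa [mem_ofAut, this]
  · obtain ⟨n, hn⟩ := exists_forall_eqOn hU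
    refine mem_comap.2 ⟨{β | {g.toEmbedding.comp (A L n).subtype} ∈ β.1 n}, ?_, fun h hh => ?_⟩
    · exact ((ultrafilter_isOpen_basic _).preimage (continuous_coord n)).mem_nhds
        (mem_ofAut.2 rfl)
    · exact hn h fun i hi => DFunLike.congr_fun (mem_singleton_iff.1 (mem_ofAut.1 hh)) ⟨i, hi⟩

end Continuity

/-! ### Extending orbit maps to the greatest ambit -/

section Extension

variable {L : FirstOrder.Language.{u, v}} [L.Structure ℕ]

/-- Compactness makes continuity at `1` uniform in the point; this is applied to `g⁻¹ * h` at the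
point `x · g`. -/
theorem IsFlow.exists_stabilizer_small {X : Type w} [UniformSpace X] [MulAction (Aut L)ᵐᵒᵖ X]
    (hX : IsFlow (Aut L) X) {W : Set (X × X)} (hW : W ∈ uniformity X) :
    ∃ n, ∀ g h : Aut L, (∀ i ≤ n, g i = h i) →
      ∀ x : X, (MulOpposite.op g • x, MulOpposite.op h • x) ∈ W := by
  have := hX.compact
  have hev : ∀ᶠ u in 𝓝 (1 : Aut L), ∀ x ∈ (univ : Set X), (x, MulOpposite.op u • x) ∈ W := by
    refine isCompact_univ.eventually_forall_of_forall_eventually fun x _ => ?_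
    have hc : Continuous fun p : Aut L × X => (p.2, MulOpposite.op p.1 • p.2) :=
      continuous_snd.prodMk (hX.continuous_action.comp continuous_swap)
    refine hc.continuousAt.preimage_mem_nhds ?_
    simp only [MulOpposite.op_one, one_smul]
    exact nhds_le_uniformity x hW
  obtain ⟨n, hn⟩ := exists_forall_eqOn hev
  refine ⟨n, fun g h hgh x => ?_⟩
  have h1 := hn (g⁻¹ * h) (fun i hi => ?_) (MulOpposite.op g • x) trivial
  · rwa [smul_smul, ← MulOpposite.op_mul, mul_inv_cancel_left] at h1
  · change g.symm (h i) = i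
    rw [← hgh i hi]
    exact g.symm_apply_apply i

variable [L.IsRelational]

/-- Up to a small entourage `x · g` depends only on `g|_{A_n}`, so it is nearly a function on `H_n`,
which converges along `α(n)` by compactness. Hence the image filter is Cauchy. -/
theorem IsFlow.exists_tendsto {X : Type w} [TopologicalSpace X] [MulAction (Aut L)ᵐᵒᵖ X]
    (hX : IsFlow (Aut L) X) (hu : L.IsUltrahomogeneous ℕ) (x : X) (α : LimBeta L) :
    ∃ c, Tendsto (fun g : Aut L => MulOpposite.op g • x) (comap ofAut (𝓝 α)) (𝓝 c) := by
  have := hX.compact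
  have := hX.hausdorff
  let _ : UniformSpace X := uniformSpaceOfCompactR1
  have hne : (comap (ofAut : Aut L → LimBeta L) (𝓝 α)).NeBot :=
    (IsDenseInducing.mk isInducing_ofAut (denseRange_ofAut hu)).comap_nhds_neBot α
  refine cauchy_map_iff_exists_tendsto.1 (cauchy_map_iff'.2 fun W hW => ?_)
  obtain ⟨V, hV, hVs, hVW⟩ := comp_symm_mem_uniformity_sets hW
  obtain ⟨T, hT, hTs, hTV⟩ := comp_symm_mem_uniformity_sets hV
  obtain ⟨n, hn⟩ := hX.exists_stabilizer_small hT
  choose s hs using fun f : H L n => exists_aut hu f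
  obtain ⟨c, -, hc⟩ := (isCompact_univ (X := X)).ultrafilter_le_nhds
    ((α.1 n).map fun f => MulOpposite.op (s f) • x) (by simp)
  have hS : {f : H L n | (MulOpposite.op (s f) • x, c) ∈ T} ∈ α.1 n :=
    hc (mem_nhds_right c hT)
  have hF : {g : Aut L | (MulOpposite.op g • x, c) ∈ V} ∈ comap ofAut (𝓝 α) := by
    refine mem_comap.2 ⟨_, ((ultrafilter_isOpen_basic _).preimage
      (continuous_coord n)).mem_nhds hS, fun g hg => hTV ?_⟩
    exact ⟨_, hn g _ (fun i hi => hs (g.toEmbedding.comp (A L n).subtype) ⟨i, hi⟩) x, hg⟩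
  refine mem_map.2 (mem_of_superset (prod_mem_prod hF hF) fun p hp => hVW ?_)
  exact ⟨c, hp.1, hVs.symm _ _ hp.2⟩

theorem IsFlow.exists_extension {X : Type w} [TopologicalSpace X] [MulAction (Aut L)ᵐᵒᵖ X]
    (hX : IsFlow (Aut L) X) (hu : L.IsUltrahomogeneous ℕ) (x : X) :
    ∃ φ : LimBeta L → X, Continuous φ ∧ ∀ g : Aut L, φ (ofAut g) = MulOpposite.op g • x := by
  have := hX.compact
  have := hX.hausdorff
  have di : IsDenseInducing (ofAut : Aut L → LimBeta L) :=
    ⟨isInducing_ofAut, denseRange_ofAut hu⟩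
  have hc : Continuous fun g : Aut L => MulOpposite.op g • x :=
    hX.continuous_action.comp (continuous_const.prodMk continuous_id)
  exact ⟨_, di.continuous_extend (hX.exists_tendsto hu x), di.extend_eq hc⟩

/-- The inverse limit is the greatest ambit: it maps to every flow. -/
theorem IsFlow.exists_isGMap {X : Type w} [TopologicalSpace X] [MulAction (Aut L)ᵐᵒᵖ X]
    (hX : IsFlow (Aut L) X) (hu : L.IsUltrahomogeneous ℕ) :
    ∃ f : LimBeta L → X, IsGMap (Aut L) f := by
  have := hX.hausdorff
  obtain ⟨x⟩ := hX.nonempty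
  obtain ⟨φ, hφ, hφx⟩ := hX.exists_extension hu x
  refine ⟨φ, hφ, fun g α => ?_⟩
  have h1 : Continuous fun α : LimBeta L => φ (MulOpposite.op g • α) :=
    hφ.comp (continuous_act_left g)
  have h2 : Continuous fun α : LimBeta L => MulOpposite.op g • φ α :=
    hX.continuous_action.comp (hφ.prodMk (continuous_const (y := g)))
  refine congrFun ((denseRange_ofAut hu).equalizer h1 h2 (funext fun h => ?_)) α
  simp only [Function.comp_apply]
  rw [← ofAut_mul, hφx, hφx, MulOpposite.op_mul, mul_smul]

end Extension

/-! ### General facts on minimal flows -/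

section Minimal

variable {G : Type u} [Group G]

theorem IsGMap.comp {X Z W : Type*} [TopologicalSpace X] [MulAction Gᵐᵒᵖ X]
    [TopologicalSpace Z] [MulAction Gᵐᵒᵖ Z] [TopologicalSpace W] [MulAction Gᵐᵒᵖ W]
    {f : Z → W} {g : X → Z} (hf : IsGMap G f) (hg : IsGMap G g) : IsGMap G (f ∘ g) :=
  ⟨hf.continuous.comp hg.continuous, fun a x => by
    rw [Function.comp_apply, hg.map_act, hf.map_act, Function.comp_apply]⟩

theorem IsGMap.surjective [TopologicalSpace G] {X Z : Type*} [TopologicalSpace X] [MulAction Gᵐᵒᵖ X]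
    [TopologicalSpace Z] [MulAction Gᵐᵒᵖ Z] {f : X → Z} (hf : IsGMap G f)
    (hX : IsFlow G X) (hZ : IsMinimalFlow G Z) : Function.Surjective f := by
  have := hX.compact
  have := hZ.isFlow.hausdorff
  obtain ⟨x⟩ := hX.nonempty
  have hcl : IsClosed (range f) := (isCompact_range hf.continuous).isClosed
  rw [← range_eq_univ, ← hcl.closure_eq]
  refine ((hZ.dense_orbit (f x)).mono ?_).closure_eq
  rintro _ ⟨g, rfl⟩
  exact ⟨_, hf.map_act g x⟩

/-- In a minimal flow, finitely many translates of a nonempty open set cover the space. -/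
theorem IsMinimalFlow.exists_finset [TopologicalSpace G] {X : Type*} [TopologicalSpace X] [MulAction Gᵐᵒᵖ X]
    (hX : IsMinimalFlow G X) {U : Set X} (hU : IsOpen U) (hne : U.Nonempty) :
    ∃ F : Finset G, ∀ x : X, ∃ g ∈ F, MulOpposite.op g • x ∈ U := by
  have := hX.isFlow.compact
  obtain ⟨F, hF⟩ := isCompact_univ.elim_finite_subcover
    (fun g : G => (fun x : X => MulOpposite.op g • x) ⁻¹' U)
    (fun g => hU.preimage (hX.isFlow.continuous_action.comp
      (continuous_id.prodMk continuous_const)))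
    (fun x _ => by
      obtain ⟨_, hy, g, rfl⟩ := (hX.dense_orbit x).inter_open_nonempty U hU hne
      exact mem_iUnion.2 ⟨g, hy⟩)
  refine ⟨F, fun x => ?_⟩
  obtain ⟨g, hg, hgx⟩ := mem_iUnion₂.1 (hF (mem_univ x))
  exact ⟨g, hg, hgx⟩

end Minimal

/-! ### The Ramsey degree as a bound on invariant colorings -/

section Bound

variable {L : FirstOrder.Language.{u, v}} [L.Structure ℕ] [L.IsRelational]

/-- The Ramsey degree of `A_m` bounds the number of values of a locally constant function on a
minimal flow which is invariant under the stabilizer of `A_m`. -/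
theorem IsMinimalFlow.card_le_of_invariant {𝒦 : Set (Bundled.{0} L.Structure)}
    (h𝒦 : L.age ℕ = 𝒦) (hu : L.IsUltrahomogeneous ℕ) {X : Type*} [TopologicalSpace X]
    [MulAction (Aut L)ᵐᵒᵖ X] (hX : IsMinimalFlow (Aut L) X) {m k r : ℕ}
    (hdeg : HasRamseyDegree 𝒦 (A L m) k) (c : X → Fin r) (hc : Continuous c)
    (hsurj : Function.Surjective c)
    (hinv : ∀ (u : Aut L), (∀ i ≤ m, u i = i) → ∀ x, c (MulOpposite.op u • x) = c x) :
    r ≤ k := by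
  by_contra! hr
  obtain ⟨x⟩ := hX.isFlow.nonempty
  -- The color of `x · g` depends only on `g|_{A_m}`, so `c` induces a coloring of `H_m`.
  have hinv' : ∀ g h : Aut L, (∀ i ≤ m, g i = h i) →
      c (MulOpposite.op g • x) = c (MulOpposite.op h • x) := by
    intro g h hgh
    rw [← hinv (g⁻¹ * h) (fun i hi => ?_) (MulOpposite.op g • x), smul_smul,
      ← MulOpposite.op_mul, mul_inv_cancel_left]
    change g.symm (h i) = i
    rw [← hgh i hi]
    exact g.symm_apply_apply i
  choose F hF using fun i : Fin r => hX.exists_finset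
    ((isOpen_discrete {i}).preimage hc) (hsurj i)
  obtain ⟨N, hN⟩ := ((Set.finite_iUnion fun i : Fin r => (F i).finite_toSet).image
    (fun g => bd g m)).bddAbove
  have hbd : ∀ i, ∀ g ∈ F i, ∀ j ≤ m, g j ≤ max m N := fun i g hg j hj =>
    (((le_bd g m) j hj).trans (hN ⟨g, mem_iUnion.2 ⟨i, hg⟩, rfl⟩)).trans (le_max_right _ _)
  choose s hs using fun f : H L m => exists_aut hu f
  obtain ⟨f, hf⟩ := hdeg.exists_ncard_le h𝒦 hr (fun f => c (MulOpposite.op (s f) • x))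
    ⟨incl (le_max_left m N)⟩
  obtain ⟨h, hh⟩ := exists_aut hu f
  -- Every copy `h` of the large structure shows all colors: some `g ∈ F i` moves `x · h` into color
  -- `i`, and `g` maps `A_m` into that structure.
  have huniv : (range fun e : A L m ↪[L] A L (max m N) =>
      c (MulOpposite.op (s (pull e f)) • x)) = univ := by
    refine eq_univ_of_forall fun i => ?_
    obtain ⟨g, hg, hgi⟩ := hF i (MulOpposite.op h • x)
    refine ⟨res g (hbd i g hg), ?_⟩
    rw [smul_smul, ← MulOpposite.op_mul] at hgi
    refine (hinv' _ (h * g) fun j hj => ?_).trans hgi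
    rw [← hs (pull (res g (hbd i g hg)) f) ⟨j, hj⟩]
    exact hh (res g (hbd i g hg) ⟨j, hj⟩)
  rw [huniv, ncard_univ, Nat.card_fin] at hf
  omega

end Bound

end UMF

namespace UMF

open Set Filter Topology FirstOrder.Language

/-! ### Invariance, minimality and coalescence of the limit -/

section InverseLimit

variable {L : FirstOrder.Language.{u, v}} [L.Structure ℕ] [L.IsRelational]
  {𝒦 : Set (Bundled.{0} L.Structure)} {Y : ∀ n : ℕ, Set (Ultrafilter (H L n))}

theorem limSet_nonempty (hY : IsInverseSystem Y) (hfin : ∀ n, (Y n).Finite)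
    (hne : ∀ n, (Y n).Nonempty) : (limSet Y).Nonempty := by
  let F : ℕᵒᵖ ⥤ Type :=
    { obj := fun n => Y n.unop
      map := fun {n m} h => ↾fun p => ⟨bond h.unop.le p.1, hY _ _ h.unop.le p.2⟩
      map_id := fun n => by
        ext p
        rfl
      map_comp := fun {a b c} f g => by
        ext p
        rfl }
  have : ∀ n, Finite (F.obj n) := fun n => (hfin n.unop).to_subtype
  have : ∀ n, Nonempty (F.obj n) := fun n => (hne n.unop).to_subtype
  obtain ⟨s, hs⟩ := nonempty_sections_of_finite_inverse_system F
  exact ⟨⟨fun n => (s (Opposite.op n)).1, fun m n h =>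
    congrArg Subtype.val (hs (homOfLE h).op)⟩, fun n => (s (Opposite.op n)).2⟩

theorem isClosed_limSet (hfin : ∀ n, (Y n).Finite) : IsClosed (limSet Y) := by
  have : limSet Y = ⋂ n, (fun α : LimBeta L => α.1 n) ⁻¹' Y n := by
    ext α
    simp [limSet]
  rw [this]
  exact isClosed_iInter fun n => (hfin n).isClosed.preimage (continuous_coord n)

theorem map_pull_mem_of_mem_limSet (h𝒦 : L.age ℕ = 𝒦) (hu : L.IsUltrahomogeneous ℕ)
    (hY : IsInverseSystem Y) (hfin : ∀ n, (Y n).Finite) (hthick : ∀ n, IsThickFamily 𝒦 (Y n))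
    (hdeg : ∀ n, HasRamseyDegree 𝒦 (A L n) (Y n).ncard) {α : LimBeta L} (hα : α ∈ limSet Y)
    {m n : ℕ} (e : A L m ↪[L] A L n) : (α.1 n).map (pull e) ∈ Y m := by
  have h := map_pull_mem h𝒦 hu (le_max_left m n) (hfin m) (hfin _) (hthick _) (hdeg _)
    (hY _ _ _) ((incl (le_max_right m n)).comp e) (hα (max m n))
  rwa [← map_pull_pull, ← bond, α.2] at h

theorem smul_mem_limSet (h𝒦 : L.age ℕ = 𝒦) (hu : L.IsUltrahomogeneous ℕ)
    (hY : IsInverseSystem Y) (hfin : ∀ n, (Y n).Finite) (hthick : ∀ n, IsThickFamily 𝒦 (Y n))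
    (hdeg : ∀ n, HasRamseyDegree 𝒦 (A L n) (Y n).ncard) (g : (Aut L)ᵐᵒᵖ) {α : LimBeta L}
    (hα : α ∈ limSet Y) : g • α ∈ limSet Y := fun _ =>
  map_pull_mem_of_mem_limSet h𝒦 hu hY hfin hthick hdeg hα _

/-- The translates of a point of the limit realize every member of `Y_m` in coordinate `m`. -/
theorem exists_smul_coord_eq (h𝒦 : L.age ℕ = 𝒦) (hu : L.IsUltrahomogeneous ℕ)
    (hY : IsInverseSystem Y) (hfin : ∀ n, (Y n).Finite) (hthick : ∀ n, IsThickFamily 𝒦 (Y n))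
    (hdeg : ∀ n, HasRamseyDegree 𝒦 (A L n) (Y n).ncard) {α : LimBeta L} (hα : α ∈ limSet Y)
    {m : ℕ} {q : Ultrafilter (H L m)} (hq : q ∈ Y m) :
    ∃ g : Aut L, (MulOpposite.op g • α).1 m = q := by
  obtain ⟨n, e, he⟩ := exists_pull_eq h𝒦 (hfin m) (hdeg m) α
    (fun n e => map_pull_mem_of_mem_limSet h𝒦 hu hY hfin hthick hdeg hα e) hq
  obtain ⟨g, hg⟩ := exists_aut hu ((A L n).subtype.comp e)
  have hgn : ∀ i ≤ m, g i ≤ n := fun i hi => (hg ⟨i, hi⟩).symm.trans_le (e ⟨i, hi⟩).2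
  refine ⟨g, (act_val α g hgn).trans ?_⟩
  rw [← he]
  congr 2
  ext i
  exact (hg i).symm

/-- The coordinate `m` of a limit point is fixed by the stabilizer of `A_m`. -/
theorem smul_coord_of_fixes {m : ℕ} {u : Aut L} (hfix : ∀ i ≤ m, u i = i) (α : LimBeta L) :
    (MulOpposite.op u • α).1 m = α.1 m := by
  have hm : ∀ i ≤ m, u i ≤ m := fun i hi => (hfix i hi).trans_le hi
  have h1 : ∀ i ≤ m, (1 : Aut L) i ≤ m := fun i hi => hi
  have h2 : (act α 1).1 m = α.1 m := by rw [act_one]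
  rw [← h2, act_val α 1 h1, pull_res hm h1 fun i hi => (hfix i hi).symm]
  exact act_val α u hm

variable (Z : SubMulAction (Aut L)ᵐᵒᵖ (LimBeta L))

theorem isMinimalFlow_of_coe_eq_limSet (h𝒦 : L.age ℕ = 𝒦) (hu : L.IsUltrahomogeneous ℕ)
    (hY : IsInverseSystem Y) (hfin : ∀ n, (Y n).Finite) (hthick : ∀ n, IsThickFamily 𝒦 (Y n))
    (hdeg : ∀ n, HasRamseyDegree 𝒦 (A L n) (Y n).ncard) (hZ : (Z : Set (LimBeta L)) = limSet Y) :
    IsMinimalFlow (Aut L) Z where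
  isFlow :=
    { nonempty := by
        have := limSet_nonempty hY hfin fun n => (hthick n).nonempty h𝒦
        rw [← hZ] at this
        exact this.to_subtype
      compact := by
        have := isClosed_limSet hfin
        rw [← hZ] at this
        exact isCompact_iff_compactSpace.1 this.isCompact
      hausdorff := inferInstanceAs (T2Space (Subtype _))
      continuous_action := by
        have h : Continuous fun p : Z × Aut L => ((p.1 : LimBeta L), p.2) :=
          (continuous_subtype_val.comp continuous_fst).prodMk continuous_snd
        exact continuous_induced_rng.2 (continuous_act.comp h :) }
  dense_orbit := by
    rintro ⟨α, hα⟩ ⟨β, hβ⟩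
    rw [mem_closure_iff_nhds]
    intro U hU
    rw [nhds_subtype, mem_comap] at hU
    obtain ⟨V, hV, hVU⟩ := hU
    obtain ⟨n, S, hS, hSV⟩ := exists_basic_nhds hV
    have hα' : α ∈ limSet Y := hZ ▸ hα
    have hβ' : β ∈ limSet Y := hZ ▸ hβ
    -- A basic neighborhood constrains a single coordinate, so matching `β` there suffices.
    obtain ⟨g, hg⟩ := exists_smul_coord_eq h𝒦 hu hY hfin hthick hdeg hα' (hβ' n)
    exact ⟨MulOpposite.op g • ⟨α, hα⟩, hVU (hSV _ (hg.symm ▸ hS)), g, rfl⟩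

/-- Every endomorphism of the inverse limit is injective. -/
theorem injective_of_isGMap (h𝒦 : L.age ℕ = 𝒦) (hu : L.IsUltrahomogeneous ℕ)
    (hY : IsInverseSystem Y) (hfin : ∀ n, (Y n).Finite) (hthick : ∀ n, IsThickFamily 𝒦 (Y n))
    (hdeg : ∀ n, HasRamseyDegree 𝒦 (A L n) (Y n).ncard) (hZ : (Z : Set (LimBeta L)) = limSet Y)
    {ψ : Z → Z} (hψ : IsGMap (Aut L) ψ) : Function.Injective ψ := by
  have hmin := isMinimalFlow_of_coe_eq_limSet Z h𝒦 hu hY hfin hthick hdeg hZ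
  have hψs : Function.Surjective ψ := hψ.surjective hmin.isFlow hmin
  have hmem : ∀ z : Z, z.1 ∈ limSet Y := fun z => hZ ▸ z.2
  have hfinY : ∀ m, Finite (Y m) := fun m => (hfin m).to_subtype
  let π : ∀ m, Z → Y m := fun m z => ⟨z.1.1 m, hmem z m⟩
  have hπ : ∀ m, Continuous (π m) := fun m =>
    ((continuous_coord m).comp continuous_subtype_val).subtype_mk _
  have hπs : ∀ m, Function.Surjective (π m) := by
    intro m q
    obtain ⟨z⟩ := hmin.isFlow.nonempty
    obtain ⟨g, hg⟩ := exists_smul_coord_eq h𝒦 hu hY hfin hthick hdeg (hmem z) q.2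
    exact ⟨MulOpposite.op g • z, Subtype.ext hg⟩
  have hfix : ∀ m, ∀ g : Aut L, (∀ i ≤ m, g i = i) → ∀ z, π m (MulOpposite.op g • z) = π m z :=
    fun m g hg z => Subtype.ext (smul_coord_of_fixes hg z.1)
  -- coordinate `m` of the image depends only on coordinate `m`
  have hdep : ∀ m z z', π m z = π m z' → π m (ψ z) = π m (ψ z') := by
    intro m
    -- This pair takes at most `|Y_m|` values by the degree bound, and its first component already
    -- takes that many. So its range is the graph of a function.
    let c : Z → Y m × Y m := fun z => (π m z, π m (ψ z))
    have hc : Continuous c := (hπ m).prodMk ((hπ m).comp hψ.continuous)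
    let E := Finite.equivFin (range c)
    have hle : Nat.card (range c) ≤ (Y m).ncard := by
      refine hmin.card_le_of_invariant h𝒦 hu (hdeg m) (fun z => E (rangeFactorization c z))
        (continuous_of_discreteTopology.comp (hc.subtype_mk _))
        (E.surjective.comp rangeFactorization_surjective) fun g hg z => ?_
      refine congrArg E (Subtype.ext ?_)
      change (π m _, π m (ψ _)) = (π m z, π m (ψ z))
      rw [hψ.map_act, hfix m g hg, hfix m g hg]
    have hfst : Function.Surjective fun x : range c => x.1.1 := fun q => by
      obtain ⟨z, hz⟩ := hπs m q
      exact ⟨⟨c z, z, rfl⟩, hz⟩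
    have hinj := (Function.Surjective.bijective_of_nat_card_le hfst hle).injective
    intro z z' hzz
    have := @hinj ⟨c z, z, rfl⟩ ⟨c z', z', rfl⟩ hzz
    exact congrArg (fun x => x.1.2) this
  intro z z' hzz
  refine Subtype.ext (Subtype.ext (funext fun m => ?_))
  choose s hs using hπs m
  -- The induced self-map of the finite set `Y_m` is onto because `ψ` is, hence injective.
  have hσ : Function.Surjective fun q => π m (ψ (s q)) := fun q => by
    obtain ⟨y, hy⟩ := hπs m q
    obtain ⟨x, rfl⟩ := hψs y
    exact ⟨π m x, (hdep m _ _ (hs _)).trans hy⟩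
  have hσi := Finite.injective_iff_surjective.2 hσ
  refine congrArg Subtype.val (@hσi (π m z) (π m z') ?_)
  change π m (ψ (s _)) = π m (ψ (s _))
  rw [hdep m _ z (hs _), hdep m _ z' (hs _), hzz]

end InverseLimit

end UMF

theorem corollary8p8 (L : FirstOrder.Language.{u, v}) [L.IsRelational] [L.Structure ℕ]
    (𝒦 : Set (Bundled.{0} L.Structure)) (h𝒦 : FirstOrder.Language.IsFraisseLimit 𝒦 ℕ)
    (Y : ∀ n : ℕ, Set (Ultrafilter (UMF.H L n)))
    (hY : UMF.IsInverseSystem Y)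
    (hfin : ∀ n, (Y n).Finite)
    (hthick : ∀ n, UMF.IsThickFamily 𝒦 (Y n))
    (hdeg : ∀ n, UMF.HasRamseyDegree 𝒦 (UMF.A L n) (Y n).ncard) :
    ∃ Z : SubMulAction (UMF.Aut L)ᵐᵒᵖ (UMF.LimBeta L),
      (Z : Set (UMF.LimBeta L)) = UMF.limSet Y ∧
      UMF.IsUniversalMinimalFlow.{w} (UMF.Aut L) Z ∧
      ∀ (M : Type w) [TopologicalSpace M] [MulAction (UMF.Aut L)ᵐᵒᵖ M],
        UMF.IsUniversalMinimalFlow.{0} (UMF.Aut L) M → UMF.FlowIso (UMF.Aut L) Z M := by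
  have hu := h𝒦.ultrahomogeneous
  have hage := h𝒦.age
  let Z : SubMulAction (UMF.Aut L)ᵐᵒᵖ (UMF.LimBeta L) :=
    { carrier := UMF.limSet Y
      smul_mem' := fun g _ hα => UMF.smul_mem_limSet hage hu hY hfin hthick hdeg g hα }
  have hmin : UMF.IsMinimalFlow (UMF.Aut L) Z :=
    UMF.isMinimalFlow_of_coe_eq_limSet Z hage hu hY hfin hthick hdeg rfl
  have huniv : ∀ (M : Type w) [TopologicalSpace M] [MulAction (UMF.Aut L)ᵐᵒᵖ M],
      UMF.IsMinimalFlow (UMF.Aut L) M → ∃ f : Z → M, UMF.IsGMap (UMF.Aut L) f := by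
    intro M _ _ hM
    obtain ⟨f, hf⟩ := hM.isFlow.exists_isGMap hu
    exact ⟨fun z => f z.1, hf.continuous.comp continuous_subtype_val, fun g z => hf.map_act g z.1⟩
  refine ⟨Z, rfl, ⟨hmin, huniv⟩, fun M _ _ hM => ?_⟩
  obtain ⟨f, hf⟩ := huniv M hM.isMinimalFlow
  -- The composite endomorphism of `Z` is injective by coalescence, which makes `f` injective;
  -- minimality of `M` makes `f` onto.
  obtain ⟨g, hg⟩ := hM.universal Z hmin
  have hinj : Function.Injective (g ∘ f) :=
    UMF.injective_of_isGMap Z hage hu hY hfin hthick hdeg rfl (hg.comp hf)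
  exact ⟨f, hf, hinj.of_comp, hf.surjective hmin.isFlow hM.isMinimalFlow⟩
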